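/- Consider a market with $n$ buyers and $m$ sellers, each seller holding one item and each buyer wanting at most one item. The goods are homogeneous: buyer $i$ has the same value $v_i\ge 0$ for the item of every seller. A bipartite graph $G$ says which buyers and sellers can trade directly. For a set $P$ of sellers who join a platform, let $G(P)$ be the graph obtained from $G$ by linking every seller of $P$ to every buyer, and let $W(G(P))$ be the largest total value of a matching in $G(P)$; let $W^\star$ be the largest total value of a matching in the complete bipartite graph. A competitive equilibrium of a graph consists of item prices $p_j\ge 0$ and an assignment of items to buyers along edges of the graph (each buyer gets at most one item, each item is sold at most once) such that every buyer $i$ has utility (value minus price of the item received, or $0$ without an item) at least $0$ and at least $v_i-p_j$ for every linked seller $j$, and every unsold item has price $0$. Let $p_j(P)$ be the maximum price of $j$ over all competitive equilibria of $G(P)$. At a transaction fee $\alpha\in[0,1]$, seller $j$ has utility $u_j(P,\alpha)=(1-\alpha)p_j(P)$ if $j\in P$ and $u_j(P,\alpha)=p_j(P)$ if $j\notin P$. A (mixed) Platform Equilibrium at fee $\alpha$ is a vector $\mathbf x\in[0,1]^m$ such that, when each seller $j$ joins independently with probability $x_j$, for every seller $j$ $$\mathbb E_{P\sim \mathbf x}[u_j(P,\alpha)]\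 \ge\ \max\bigl(\mathbb E_{P\sim \mathbf x_{-j}}[u_j(P,\alpha)],\ \mathbb E_{P\sim \mathbf x_{-j}}[u_j(P\cup\{j\},\alpha)]\bigr),$$ where $P\sim\mathbf x_{-j}$ is the random set of joining sellers among those other than $j$; pure equilibria are the case $\mathbf x\in\{0,1\}^m$. The platform is unregulated: it selects a pair $(\alpha^\star,\mathbf x^\star)$, with $\alpha^\star\in[0,1]$ and $\mathbf x^\star$ a Platform Equilibrium at fee $\alpha^\star$, that maximizes the expected revenue $\mathbb E_{P\sim\mathbf x}\bigl[\alpha\sum_{j\in P}p_j(P)\bigr]$ over all such pairs $(\alpha,\mathbf x)$. Theorem. There is an absolute constant $c>0$ such that for all $n,m$ with $\min\{n,m\}\ge 2$ and every homogeneous-goods market with $n$ buyers and $m$ sellers, a revenue-maximizing pair exists, and every revenue-maximizing pair $(\alpha^\star,\mathbf x^\star)$ satisfies $$\mathbb E_{P\sim\mathbf x^\star}\bigl[W(G(P))\bigr]\ \ge\ \frac{c}{\log\min\{n,m\}}\,W^\star .$$ That is, the price of anarchy is $O(\log\min\{n,m\})$. -/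

import Mathlib

/-- A unit-demand buyer-seller network with `n` buyers and `m` sellers, each seller holding one
item: `value i j` is the value of buyer `i` for the item of seller `j`, and `link i j` says that
buyer `i` and seller `j` can transact directly. -/
structure Market (n m : ℕ) where
  value : Fin n → Fin m → ℝ
  value_nonneg : ∀ i j, 0 ≤ value i j
  link : Fin n → Fin m → Prop

namespace Market

variable {n m : ℕ}

/-- Homogeneous goods: each buyer values the items of all sellers equally. -/
def IsHomogeneous (M : Market n m) : Prop :=
  ∃ v : Fin n → ℝ, ∀ i j, M.value i j = v i

/-- The network `G(P)` formed when the sellers in `P` join the platform: they become linked to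
every buyer, and the links of the other sellers are unchanged. -/
def join (M : Market n m) (P : Finset (Fin m)) : Market n m where
  value := M.value
  value_nonneg := M.value_nonneg
  link := fun i j => j ∈ P ∨ M.link i j

/-- The same buyers and sellers on the complete bipartite graph. -/
def complete (M : Market n m) : Market n m where
  value := M.value
  value_nonneg := M.value_nonneg
  link := fun _ _ => True

/-- An allocation gives each buyer at most one item (`none`: the buyer gets nothing). It is
feasible if trades respect the links and each item is sold at most once. -/
def IsFeasible (M : Market n m) (a : Fin n → Option (Fin m)) : Prop :=
  (∀ i j, a i = some j → M.link i j) ∧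
  (∀ i i' j, a i = some j → a i' = some j → i = i')

/-- Social welfare of an allocation: the total value that the buyers obtain. -/
def allocWelfare (M : Market n m) (a : Fin n → Option (Fin m)) : ℝ :=
  ∑ i, (a i).elim 0 (fun j => M.value i j)

/-- The optimal welfare over all feasible allocations (a maximum over a finite set that contains
the empty allocation). -/
noncomputable def welfare (M : Market n m) : ℝ :=
  sSup {w | ∃ a, M.IsFeasible a ∧ w = M.allocWelfare a}

/-- The ideal welfare `W*`: the optimal welfare when every buyer can trade with every seller. -/
noncomputable def idealWelfare (M : Market n m) : ℝ :=
  M.complete.welfare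

/-- Utility of buyer `i` under prices `p` and allocation `a`. -/
def buyerUtility (M : Market n m) (p : Fin m → ℝ) (a : Fin n → Option (Fin m)) (i : Fin n) : ℝ :=
  (a i).elim 0 (fun j => M.value i j - p j)

/-- Competitive (Walrasian) equilibrium of the network. -/
structure IsCompetitiveEquilibrium (M : Market n m) (p : Fin m → ℝ)
    (a : Fin n → Option (Fin m)) : Prop where
  price_nonneg : ∀ j, 0 ≤ p j
  feasible : M.IsFeasible a
  most_preferred : ∀ i j, M.link i j → M.value i j - p j ≤ M.buyerUtility p a i
  utility_nonneg : ∀ i, 0 ≤ M.buyerUtility p a i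
  unsold_price : ∀ j, (∀ i, a i ≠ some j) → p j = 0

/-- The maximum competitive price of seller `j`: the largest `j`-th coordinate of a competitive
price vector. -/
noncomputable def maxPrice (M : Market n m) (j : Fin m) : ℝ :=
  sSup {r | ∃ p a, M.IsCompetitiveEquilibrium p a ∧ r = p j}

/-- Utility of seller `j` when the set `P` of sellers is on the platform, the transaction fee is
`α`, and the market clears at the maximum competitive prices of `G(P)`. -/
noncomputable def sellerUtility (M : Market n m) (α : ℝ) (P : Finset (Fin m)) (j : Fin m) : ℝ :=
  if j ∈ P then (1 - α) * (M.join P).maxPrice j else (M.join P).maxPrice j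

/-- Expectation of `f P` when each seller `j` joins `P` independently with probability `x j`. -/
noncomputable def expect (x : Fin m → ℝ) (f : Finset (Fin m) → ℝ) : ℝ :=
  ∑ P : Finset (Fin m), (∏ j, if j ∈ P then x j else 1 - x j) * f P

/-- A (mixed) Platform Equilibrium at fee `α`. Pure equilibria are those with all `x j ∈ {0, 1}`.
With `x j` replaced by `0` the random set is the choice of the sellers other than `j`. -/
def IsPlatformEquilibrium (M : Market n m) (α : ℝ) (x : Fin m → ℝ) : Prop :=
  (∀ j, x j ∈ Set.Icc (0 : ℝ) 1) ∧
  ∀ j,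
    max (expect (Function.update x j 0) (fun P => M.sellerUtility α P j))
        (expect (Function.update x j 0) (fun P => M.sellerUtility α (insert j P) j)) ≤
      expect x (fun P => M.sellerUtility α P j)

/-- Expected revenue of the platform at fee `α` and joining probabilities `x`. -/
noncomputable def revenue (M : Market n m) (α : ℝ) (x : Fin m → ℝ) : ℝ :=
  expect x (fun P => α * ∑ j ∈ P, (M.join P).maxPrice j)

/-- Expected social welfare when sellers join with probabilities `x`. -/
noncomputable def expectedWelfare (M : Market n m) (x : Fin m → ℝ) : ℝ :=
  expect x (fun P => (M.join P).welfare)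

/-- `(α, x)` is an outcome selected by an unregulated revenue-maximizing platform: a fee in
`[0, 1]` and a Platform Equilibrium at this fee whose revenue is the largest over all fees in
`[0, 1]` and all Platform Equilibria at these fees. -/
def IsPlatformOptimal (M : Market n m) (α : ℝ) (x : Fin m → ℝ) : Prop :=
  α ∈ Set.Icc (0 : ℝ) 1 ∧ M.IsPlatformEquilibrium α x ∧
  ∀ α' ∈ Set.Icc (0 : ℝ) 1, ∀ x' : Fin m → ℝ,
    M.IsPlatformEquilibrium α' x' → M.revenue α' x' ≤ M.revenue α x

end Market

/-! Let `D` be the set of buyers served in an ideal matching. If `#A * θ ≤ Φ` for every nonempty `A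
⊆ D` with values at least `θ`, then the `r`-th largest value in `D` is at most `Φ / r`, and the
ideal welfare is at most a harmonic number times `Φ` (`sum_le_harmonic_mul`). The theorem follows
with `Φ` equal to six times the expected welfare. Expected welfare is at least the base welfare and
at least the optimal revenue, so it suffices that `#A * θ > 6 * M.welfare` forces some pure
equilibrium to earn `#A * θ / 6` (`exists_equilibrium_revenue_ge`).

In that equilibrium about `#A / 2` sellers join, chosen so that those left outside have the largest
welfare in the base network. Few buyers of `A` can be served there, so demand exceeds supply on the
platform and its common price `q` is at least `θ`. By submodularity, every outside seller
contributes at least `μ`, the most that a platform seller could add to the outside sellers; hence `μ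
≤ θ / 2`. At fee `1 - μ / q` a platform seller keeps `μ`, which leaving cannot beat, and joining
does not pay either.

The prices are computable because the maximum price is the marginal contribution (`maxPrice_eq`),
and the optimal welfare of `G(P)` splits into an optimum of the outside sellers plus the best `#P`
remaining buyers (`maxWeight_extended`). -/

open Finset

set_option linter.unusedSectionVars false

/-! ### Exchange properties of matchable sets of buyers -/

section Matchable

variable {β σ : Type*} [DecidableEq β] [DecidableEq σ] {L : β → σ → Prop}

/-- The buyers in `D` can be matched, along the links `L`, to distinct sellers in `X`. -/
def Matchable (L : β → σ → Prop) (X : Finset σ) (D : Finset β) : Prop :=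
  ∃ f : β → σ, Set.InjOn f D ∧ ∀ i ∈ D, f i ∈ X ∧ L i (f i)

namespace Matchable

variable {X Y : Finset σ} {D E : Finset β}

theorem empty [Nonempty σ] : Matchable L X ∅ :=
  ⟨fun _ => Classical.arbitrary σ, by simp, by simp⟩

theorem mono_buyers (h : Matchable L X D) (hE : E ⊆ D) : Matchable L X E := by
  obtain ⟨f, hf, hX⟩ := h
  exact ⟨f, hf.mono (by exact_mod_cast hE), fun i hi => hX i (hE hi)⟩

theorem mono_sellers (h : Matchable L X D) (hY : X ⊆ Y) : Matchable L Y D := by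
  obtain ⟨f, hf, hX⟩ := h
  exact ⟨f, hf, fun i hi => ⟨hY (hX i hi).1, (hX i hi).2⟩⟩

theorem insert_of_erase {i : β} {k : σ} (h : Matchable L (X.erase k) D) (hk : k ∈ X)
    (hL : L i k) : Matchable L X (insert i D) := by
  obtain ⟨f, hf, hX⟩ := h
  refine ⟨Function.update f i k, ?_, ?_⟩
  · intro a ha b hb hab
    simp only [coe_insert, Set.mem_insert_iff, mem_coe] at ha hb
    have hne : ∀ x ∈ D, f x ≠ k := fun x hx => (mem_erase.1 (hX x hx).1).1
    by_cases h1 : a = i <;> by_cases h2 : b = i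
    · rw [h1, h2]
    · subst h1
      rw [Function.update_self, Function.update_of_ne h2] at hab
      exact absurd hab.symm (hne b (hb.resolve_left h2))
    · subst h2
      rw [Function.update_self, Function.update_of_ne h1] at hab
      exact absurd hab (hne a (ha.resolve_left h1))
    · rw [Function.update_of_ne h1, Function.update_of_ne h2] at hab
      exact hf (ha.resolve_left h1) (hb.resolve_left h2) hab
  · intro a ha
    by_cases h1 : a = i
    · subst h1
      rw [Function.update_self]
      exact ⟨hk, hL⟩
    · rw [Function.update_of_ne h1]
      have := hX a ((mem_insert.1 ha).resolve_left h1)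
      exact ⟨mem_of_mem_erase this.1, this.2⟩

theorem erase_of_forall_ne {f : β → σ} (hf : Set.InjOn f D)
    (hX : ∀ i ∈ D, f i ∈ X ∧ L i (f i)) {k : σ} (hk : ∀ i ∈ D, f i ≠ k) :
    Matchable L (X.erase k) D :=
  ⟨f, hf, fun i hi => ⟨mem_erase.2 ⟨hk i hi, (hX i hi).1⟩, (hX i hi).2⟩⟩

theorem erase_erase {f : β → σ} (hf : Set.InjOn f D)
    (hX : ∀ i ∈ D, f i ∈ X ∧ L i (f i)) {i : β} (hi : i ∈ D) :
    Matchable L (X.erase (f i)) (D.erase i) := by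
  refine erase_of_forall_ne (hf.mono (by simp)) (fun x hx => hX x (mem_of_mem_erase hx)) ?_
  intro x hx h
  exact (mem_erase.1 hx).1 (hf (mem_of_mem_erase hx) hi h)

/-- Exchange along an alternating path that starts at a buyer of `D` outside `E`. -/
theorem exchange {i : β} (hXY : X ⊆ Y) (hD : Matchable L X D) (hE : Matchable L Y E)
    (hiD : i ∈ D) (hiE : i ∉ E) :
    Matchable L Y (insert i E) ∨
      ∃ i' ∈ E, i' ∉ D ∧ Matchable L X (insert i' (D.erase i)) ∧
        Matchable L Y (insert i (E.erase i')) := by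
  induction hn : #D generalizing X Y D E i with
  | zero => simp_all
  | succ n ih =>
    obtain ⟨f, hf, hfX⟩ := hD
    obtain ⟨g, hg, hgY⟩ := hE
    have hkX := (hfX i hiD).1
    have hLi := (hfX i hiD).2
    have hD' := erase_erase hf hfX hiD
    by_cases hk : ∃ i₁ ∈ E, g i₁ = f i
    · obtain ⟨i₁, hi₁, hgi⟩ := hk
      have hE' := erase_erase hg hgY hi₁
      have hL₁ := (hgY i₁ hi₁).2
      rw [hgi] at hE' hL₁
      have hne : i₁ ≠ i := fun h => hiE (h ▸ hi₁)
      -- Buyer `i` takes `f i` from `i₁`. If `i₁ ∈ D`, delete this seller from both sides and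
      -- continue the path from `i₁`; otherwise the path ends with `i' = i₁`.
      by_cases hi₁D : i₁ ∈ D
      · have hi₁' : i₁ ∈ D.erase i := mem_erase.2 ⟨hne, hi₁D⟩
        rcases ih (erase_subset_erase _ hXY) hD' hE' hi₁' (by simp)
          (by rw [card_erase_of_mem hiD, hn]; rfl) with h | ⟨i', hi'E, hi'D, h1, h2⟩
        · left
          rw [insert_erase hi₁] at h
          exact h.insert_of_erase (hXY hkX) hLi
        · right
          obtain ⟨hi'1, hi'E⟩ := mem_erase.1 hi'E
          have hi'i : i' ≠ i := fun h => hiE (h ▸ hi'E)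
          refine ⟨i', hi'E, fun h => hi'D (mem_erase.2 ⟨hi'i, h⟩), ?_, ?_⟩
          · have := h1.insert_of_erase hkX hL₁
            rwa [insert_comm, insert_erase hi₁'] at this
          · have := h2.insert_of_erase (hXY hkX) hLi
            rwa [erase_right_comm, insert_erase (mem_erase.2 ⟨hi'1.symm, hi₁⟩)] at this
      · exact .inr ⟨i₁, hi₁, hi₁D, hD'.insert_of_erase hkX hL₁,
          hE'.insert_of_erase (hXY hkX) hLi⟩
    · push Not at hk
      exact .inl ((erase_of_forall_ne hg hgY hk).insert_of_erase (hXY hkX) hLi)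

/-- The matroid augmentation property: some seller is used for `E` but not for `D`. If its buyer
already lies in `D`, delete the pair and recurse. -/
theorem augment (hD : Matchable L X D) (hE : Matchable L X E) (h : #D < #E) :
    ∃ e ∈ E, e ∉ D ∧ Matchable L X (insert e D) := by
  induction hn : #D generalizing X D E with
  | zero =>
    obtain ⟨e, he⟩ := card_pos.1 (by omega : 0 < #E)
    rw [card_eq_zero] at hn
    subst hn
    exact ⟨e, he, by simp, hE.mono_buyers (by simpa using he)⟩
  | succ n ih =>
    obtain ⟨f, hf, hfX⟩ := hD
    obtain ⟨g, hg, hgX⟩ := hE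
    obtain ⟨k, hkg, hkf⟩ : ∃ k ∈ E.image g, k ∉ D.image f := by
      apply exists_mem_notMem_of_card_lt_card
      rwa [card_image_of_injOn hf, card_image_of_injOn hg]
    obtain ⟨e, he, rfl⟩ := mem_image.1 hkg
    have hD' : Matchable L (X.erase (g e)) D :=
      erase_of_forall_ne hf hfX fun x hx hx' => hkf (mem_image.2 ⟨x, hx, hx'⟩)
    by_cases heD : e ∈ D
    · obtain ⟨e', he'E, he'D, h'⟩ := ih (hD'.mono_buyers (erase_subset e D)) (erase_erase hg hgX he)
        (by rw [card_erase_of_mem heD, card_erase_of_mem he]; omega)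
        (by rw [card_erase_of_mem heD, hn]; rfl)
      obtain ⟨hne, he'E⟩ := mem_erase.1 he'E
      refine ⟨e', he'E, fun hh => he'D (mem_erase.2 ⟨hne, hh⟩), ?_⟩
      have := h'.insert_of_erase (hgX e he).1 (hgX e he).2
      rwa [insert_comm, insert_erase heD] at this
    · exact ⟨e, he, heD, hD'.insert_of_erase (hgX e he).1 (hgX e he).2⟩

/-- Moving a seller `j` from the larger to the smaller side along an alternating path. -/
theorem transfer {j : σ} (hYX : Y ⊆ X) (hjY : j ∉ Y) (hjX : j ∈ X) (hD : Matchable L X D)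
    (hE : Matchable L Y E) :
    ∃ D' E', Matchable L (X.erase j) D' ∧ Matchable L (insert j Y) E' ∧
      D' ∪ E' = D ∪ E ∧ D' ∩ E' = D ∩ E := by
  induction hn : #D generalizing X Y D E j with
  | zero =>
    rw [card_eq_zero] at hn
    subst hn
    refine ⟨∅, E, ?_, hE.mono_sellers (subset_insert _ _), rfl, rfl⟩
    obtain ⟨f, -, -⟩ := hD
    exact ⟨f, by simp, by simp⟩
  | succ n ih =>
    obtain ⟨f, hf, hfX⟩ := hD
    obtain ⟨g, hg, hgY⟩ := hE
    by_cases hk : ∃ i ∈ D, f i = j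
    · obtain ⟨i, hi, rfl⟩ := hk
      have hD' := erase_erase hf hfX hi
      have hLi := (hfX i hi).2
      -- If the buyer of `j` is also in `E`, it swaps its two sellers between the sides and `g i`
      -- becomes the seller to move; otherwise the buyer moves along with `j`.
      by_cases hiE : i ∈ E
      · have hE' := erase_erase hg hgY hiE
        have hgi := (hgY i hiE).1
        have hne : g i ≠ f i := fun h => hjY (h ▸ hgi)
        obtain ⟨D₁, E₁, h1, h2, h3, h4⟩ := ih (j := g i) (X := X.erase (f i)) (Y := Y.erase (g i))
          (fun x hx => mem_erase.2 ⟨fun h => hjY (h ▸ mem_of_mem_erase hx),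
            hYX (mem_of_mem_erase hx)⟩)
          (by simp) (mem_erase.2 ⟨hne, hYX hgi⟩) hD' hE'
          (by rw [card_erase_of_mem hi, hn]; rfl)
        refine ⟨insert i D₁, insert i E₁,
          h1.insert_of_erase (mem_erase.2 ⟨hne, hYX hgi⟩) (hgY i hiE).2,
          Matchable.insert_of_erase (k := f i) ?_ (by simp) hLi, ?_, ?_⟩
        · rw [erase_insert hjY]
          rwa [insert_erase hgi] at h2
        · rw [← insert_union_distrib, h3, ← insert_erase hi, ← insert_erase hiE]
          simp
        · rw [← insert_inter_distrib, h4, insert_inter_distrib, insert_erase hi, insert_erase hiE]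
      · refine ⟨D.erase i, insert i E, hD', Matchable.insert_of_erase (k := f i) ?_ (by simp) hLi,
          ?_, ?_⟩
        · rw [erase_insert hjY]
          exact ⟨g, hg, hgY⟩
        · rw [union_insert, ← insert_union, insert_erase hi]
        · ext x
          simp only [mem_inter, mem_erase, mem_insert]
          constructor
          · rintro ⟨⟨h1, h2⟩, h3⟩
            exact ⟨h2, h3.resolve_left h1⟩
          · rintro ⟨h1, h2⟩
            exact ⟨⟨fun h => hiE (h ▸ h2), h1⟩, .inr h2⟩
    · push Not at hk
      exact ⟨D, E, erase_of_forall_ne hf hfX hk,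
        Matchable.mono_sellers ⟨g, hg, hgY⟩ (subset_insert _ _), rfl, rfl⟩

/-- If `D` can be matched without seller `j`, and `i ∈ D` is linked to `j`, then `D` can be
matched without the seller that `i` gets in any given matching of `D`. -/
theorem erase_of_link {f : β → σ} (hf : Set.InjOn f D) (hX : ∀ i ∈ D, f i ∈ X ∧ L i (f i))
    {i : β} {j : σ} (hi : i ∈ D) (hj : j ∈ X) (hL : L i j) (hD : Matchable L (X.erase j) D) :
    Matchable L (X.erase (f i)) D := by
  classical
  by_cases hjk : j = f i
  · rwa [← hjk]
  obtain ⟨g, hg, hgX⟩ := hD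
  let t : D → Finset σ := fun x => (X.erase (f i)).filter (L x)
  -- Hall's condition without `f i`. A set avoiding `i` keeps its partners under `f`. For a set
  -- containing `i`, the partners under `g` lose at most `f i`, but `j` is a neighbour that `g`
  -- never uses and makes up for it.
  have hall : ∀ s : Finset D, #s ≤ #(s.biUnion t) := by
    intro s
    by_cases his : (⟨i, hi⟩ : D) ∈ s
    · have hjN : j ∈ s.biUnion t :=
        mem_biUnion.2 ⟨_, his, mem_filter.2 ⟨mem_erase.2 ⟨hjk, hj⟩, hL⟩⟩
      have hsub : s.image (fun x : D => g x) ⊆ insert (f i) ((s.biUnion t).erase j) := by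
        intro y hy
        obtain ⟨x, hx, rfl⟩ := mem_image.1 hy
        obtain ⟨h1, h2⟩ := hgX x x.2
        obtain ⟨h3, h4⟩ := mem_erase.1 h1
        by_cases hy' : g x = f i
        · simp [hy']
        · exact mem_insert_of_mem (mem_erase.2 ⟨h3, mem_biUnion.2 ⟨x, hx,
            mem_filter.2 ⟨mem_erase.2 ⟨hy', h4⟩, h2⟩⟩⟩)
      have h1 := card_le_card hsub
      rw [card_image_of_injective (f := fun x : D => g x) s
        (fun a b h => Subtype.ext (hg a.2 b.2 h))] at h1
      have h2 := card_insert_le (f i) ((s.biUnion t).erase j)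
      have h3 := card_erase_add_one hjN
      omega
    · rw [← card_image_of_injective s (f := fun x : D => f x)
        (fun a b h => Subtype.ext (hf a.2 b.2 h))]
      apply card_le_card
      intro y hy
      obtain ⟨x, hx, rfl⟩ := mem_image.1 hy
      refine mem_biUnion.2 ⟨x, hx, mem_filter.2 ⟨mem_erase.2 ⟨fun h => his ?_, (hX x x.2).1⟩,
        (hX x x.2).2⟩⟩
      have : x = ⟨i, hi⟩ := Subtype.ext (hf x.2 hi h)
      rwa [← this]
  obtain ⟨h, hinj, hmem⟩ := (Finset.all_card_le_biUnion_card_iff_exists_injective t).1 hall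
  refine ⟨fun x => if hx : x ∈ D then h ⟨x, hx⟩ else f i, ?_, ?_⟩
  · intro a ha b hb hab
    rw [mem_coe] at ha hb
    simp only [ha, hb, dif_pos] at hab
    simpa using hinj hab
  · intro x hx
    simp only [hx, dif_pos]
    exact mem_filter.1 (hmem ⟨x, hx⟩)

end Matchable

end Matchable

/-! ### Maximum weight over a family of sets -/

section MaxWeight

variable {β : Type*} [Finite β]

/-- The maximum total weight of a set in the family `F`. -/
noncomputable def maxWeight (v : β → ℝ) (F : Finset β → Prop) : ℝ :=
  sSup {w | ∃ D, F D ∧ w = ∑ i ∈ D, v i}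

variable {v : β → ℝ} {F G : Finset β → Prop}

theorem finite_weights (v : β → ℝ) (F : Finset β → Prop) :
    {w | ∃ D, F D ∧ w = ∑ i ∈ D, v i}.Finite := by
  have : Fintype β := Fintype.ofFinite β
  refine (Set.finite_range fun D : Finset β => ∑ i ∈ D, v i).subset ?_
  rintro w ⟨D, -, rfl⟩
  exact ⟨D, rfl⟩

theorem le_maxWeight {D : Finset β} (hD : F D) : ∑ i ∈ D, v i ≤ maxWeight v F :=
  le_csSup (finite_weights v F).bddAbove ⟨D, hD, rfl⟩

theorem exists_eq_maxWeight (h : ∃ D, F D) : ∃ D, F D ∧ ∑ i ∈ D, v i = maxWeight v F := by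
  obtain ⟨D, hD⟩ := h
  obtain ⟨D', h', h''⟩ := Set.Nonempty.csSup_mem
    (s := {w | ∃ D, F D ∧ w = ∑ i ∈ D, v i}) ⟨_, D, hD, rfl⟩ (finite_weights v F)
  exact ⟨D', h', h''.symm⟩

theorem maxWeight_le {c : ℝ} (h : ∃ D, F D) (hc : ∀ D, F D → ∑ i ∈ D, v i ≤ c) :
    maxWeight v F ≤ c := by
  obtain ⟨D, hD, h⟩ := exists_eq_maxWeight (v := v) h
  exact h ▸ hc D hD

theorem maxWeight_mono (h : ∃ D, F D) (hFG : ∀ D, F D → G D) :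
    maxWeight v F ≤ maxWeight v G :=
  maxWeight_le h fun D hD => le_maxWeight (hFG D hD)

theorem maxWeight_congr (h : ∀ D, F D ↔ G D) : maxWeight v F = maxWeight v G := by
  have : F = G := funext fun D => propext (h D)
  rw [this]

end MaxWeight

/-! ### Optimal welfare with sellers linked to everyone -/

section Extended

variable {β σ : Type*} [DecidableEq β] [DecidableEq σ] {L : β → σ → Prop}

/-- Sets of buyers that can be served by the sellers in `S` along the links and by `t` further
sellers that are linked to everyone. -/
def Extended (L : β → σ → Prop) (S : Finset σ) (t : ℕ) (D : Finset β) : Prop :=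
  ∃ D₀ ⊆ D, Matchable L S D₀ ∧ #(D \ D₀) ≤ t

/-- Sets of at most `t` buyers outside `B`. -/
def FreeSet (B : Finset β) (t : ℕ) (E : Finset β) : Prop :=
  Disjoint E B ∧ #E ≤ t

theorem freeSet_empty (B : Finset β) (t : ℕ) : ∃ E, FreeSet B t E := ⟨∅, by simp [FreeSet]⟩

variable [Finite β] {v : β → ℝ} {X Y S : Finset σ} {B : Finset β} {t : ℕ}

theorem Matchable.exists_family [Nonempty σ] : ∃ D : Finset β, Matchable L X D :=
  ⟨∅, .empty⟩

theorem Extended.exists_family [Nonempty σ] : ∃ D : Finset β, Extended L X t D :=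
  ⟨∅, ∅, by simp, .empty, by simp⟩

theorem sum_insert_erase {D : Finset β} {i i' : β} (hi : i ∈ D) (hi' : i' ∉ D) :
    ∑ x ∈ insert i' (D.erase i), v x = ∑ x ∈ D, v x - v i + v i' := by
  rw [sum_insert (fun h => hi' (mem_of_mem_erase h)), ← add_sum_erase D v hi]
  ring

/-- An optimal set for fewer sellers can be chosen inside a given optimal set. -/
theorem exists_subset_optimal [Nonempty σ] (hXY : X ⊆ Y)
    (hB : Matchable L Y B) (hopt : ∑ i ∈ B, v i = maxWeight v (Matchable L Y)) :
    ∃ D ⊆ B, Matchable L X D ∧ ∑ i ∈ D, v i = maxWeight v (Matchable L X) := by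
  obtain ⟨D, hD, hDopt⟩ := exists_eq_maxWeight (v := v) (Matchable.exists_family (L := L) (X := X))
  induction hn : #(D \ B) using Nat.strong_induction_on generalizing D with
  | _ n ih =>
    by_cases hDB : D ⊆ B
    · exact ⟨D, hDB, hD, hDopt⟩
    obtain ⟨i, hiD, hiB⟩ := not_subset.1 hDB
    -- Optimality of `B` gives `v i ≤ 0` in the first case and `v i ≤ v i'` in the second, so
    -- deleting or swapping `i` keeps `D` optimal and brings it closer to `B`.
    rcases Matchable.exchange hXY hD hB hiD hiB with h | ⟨i', hi'B, hi'D, h1, h2⟩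
    · have h3 := le_maxWeight (v := v) h
      rw [sum_insert hiB, hopt] at h3
      have h4 := add_sum_erase D v hiD
      have h5 := hD.mono_buyers (erase_subset i D)
      refine ih _ ?_ _ h5 (le_antisymm (le_maxWeight h5) ?_) rfl
      · rw [← hn]
        refine card_lt_card ⟨sdiff_subset_sdiff (erase_subset _ _) subset_rfl, fun h => ?_⟩
        simpa using h (mem_sdiff.2 ⟨hiD, hiB⟩)
      · linarith
    · have h3 := le_maxWeight (v := v) h2
      rw [sum_insert_erase hi'B hiB] at h3
      have h4 := sum_insert_erase (v := v) hiD hi'D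
      refine ih _ ?_ _ h1 (le_antisymm (le_maxWeight h1) ?_) rfl
      · rw [← hn]
        refine card_lt_card ⟨fun x hx => ?_, fun h => ?_⟩
        · simp only [mem_sdiff, mem_insert, mem_erase] at hx ⊢
          rcases hx with ⟨rfl | h, h'⟩
          · exact absurd hi'B h'
          · exact ⟨h.2, h'⟩
        · have := h (mem_sdiff.2 ⟨hiD, hiB⟩)
          simp only [mem_sdiff, mem_insert, mem_erase, ne_eq, not_true_eq_false, false_and,
            or_false] at this
          exact this.2 (this.1 ▸ hi'B)
      · linarith

/-- Removing one seller unmatches at most one buyer of `B`. As values are nonnegative, augmentation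
enlarges a nested optimum to that size without losing weight. -/
theorem exists_subset_optimal_card [Nonempty σ] {j : σ} (hv : ∀ i, 0 ≤ v i)
    (hB : Matchable L Y B) (hopt : ∑ i ∈ B, v i = maxWeight v (Matchable L Y)) :
    ∃ D ⊆ B, Matchable L (Y.erase j) D ∧ ∑ i ∈ D, v i = maxWeight v (Matchable L (Y.erase j)) ∧
      #B ≤ #D + 1 := by
  classical
  obtain ⟨J, hJB, hJ, hJc⟩ : ∃ J ⊆ B, Matchable L (Y.erase j) J ∧ #B ≤ #J + 1 := by
    obtain ⟨f, hf, hfY⟩ := hB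
    by_cases hj : ∃ i ∈ B, f i = j
    · obtain ⟨i, hi, rfl⟩ := hj
      exact ⟨B.erase i, erase_subset _ _, Matchable.erase_erase hf hfY hi, by
        rw [card_erase_add_one hi]⟩
    · push Not at hj
      exact ⟨B, subset_rfl, Matchable.erase_of_forall_ne hf hfY hj, by omega⟩
  obtain ⟨D₀, hD₀B, hD₀, hD₀opt⟩ := exists_subset_optimal (erase_subset j Y) hB hopt
  obtain ⟨D, hD, hmax⟩ := exists_max_image (B.powerset.filter fun D =>
    Matchable L (Y.erase j) D ∧ ∑ i ∈ D, v i = maxWeight v (Matchable L (Y.erase j))) card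
    ⟨D₀, by simp [hD₀B, hD₀, hD₀opt]⟩
  simp only [mem_filter, mem_powerset] at hD hmax
  refine ⟨D, hD.1, hD.2.1, hD.2.2, ?_⟩
  by_contra hlt
  obtain ⟨e, heJ, heD, he⟩ := Matchable.augment hD.2.1 hJ (by omega)
  have := hmax (insert e D) ⟨insert_subset (hJB heJ) hD.1, he, le_antisymm (le_maxWeight he) ?_⟩
  · rw [card_insert_of_notMem heD] at this
    omega
  · rw [sum_insert heD, ← hD.2.2]
    linarith [hv e]

/-- Free sellers serve the best buyers outside an optimal set of the other sellers. -/
theorem maxWeight_extended [Nonempty σ] (hv : ∀ i, 0 ≤ v i)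
    (hB : Matchable L S B) (hopt : ∑ i ∈ B, v i = maxWeight v (Matchable L S)) :
    maxWeight v (Extended L S t) = ∑ i ∈ B, v i + maxWeight v (FreeSet B t) := by
  apply le_antisymm
  · refine maxWeight_le Extended.exists_family ?_
    rintro D ⟨D₀, hD₀D, hD₀, hc⟩
    induction hn : #(B \ D₀) using Nat.strong_induction_on generalizing D D₀ with
    | _ n ih =>
      by_cases hBD : B ⊆ D₀
      · have h1 := le_maxWeight (v := v) hD₀
        have h2 : FreeSet B t (D \ D₀) := ⟨disjoint_of_subset_right hBD sdiff_disjoint, hc⟩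
        have h3 := le_maxWeight (v := v) h2
        rw [← sum_sdiff hD₀D]
        linarith
      obtain ⟨i, hiB, hiD₀⟩ := not_subset.1 hBD
      -- Pull `D₀` towards `B` one buyer at a time, without losing weight or needing more free
      -- sellers.
      rcases Matchable.exchange subset_rfl hB hD₀ hiB hiD₀ with h | ⟨i', hi'D₀, hi'B, h1, h2⟩
      · refine le_trans (sum_le_sum_of_subset_of_nonneg (subset_insert i D) fun x _ _ => hv x)
          (ih _ ?_ _ (insert i D₀) (insert_subset_insert _ hD₀D) h ?_ rfl)
        · rw [← hn]
          refine card_lt_card ⟨sdiff_subset_sdiff subset_rfl (subset_insert _ _), fun h => ?_⟩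
          simpa using h (mem_sdiff.2 ⟨hiB, hiD₀⟩)
        · refine (card_le_card fun x hx => ?_).trans hc
          simp only [mem_sdiff, mem_insert, not_or] at hx ⊢
          exact ⟨hx.1.resolve_left hx.2.1, hx.2.2⟩
      · have h3 := le_maxWeight (v := v) h1
        rw [sum_insert_erase hiB hi'B] at h3
        have hlt : #(B \ insert i (D₀.erase i')) < n := by
          rw [← hn]
          refine card_lt_card ⟨fun x hx => ?_, fun h => ?_⟩
          · simp only [mem_sdiff, mem_insert, mem_erase, not_or, not_and] at hx ⊢
            exact ⟨hx.1, hx.2.2 fun h => hi'B (h ▸ hx.1)⟩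
          · simpa using h (mem_sdiff.2 ⟨hiB, hiD₀⟩)
        have hi'D := hD₀D hi'D₀
        -- If `i` already has a free seller, that seller now serves `i'`; otherwise `i` replaces
        -- `i'`, and `v i' ≤ v i` by optimality of `B`.
        by_cases hiD : i ∈ D
        · refine ih _ hlt D _ (insert_subset hiD ((erase_subset _ _).trans hD₀D)) h2 ?_ rfl
          have : D \ insert i (D₀.erase i') ⊆ insert i' ((D \ D₀).erase i) := by
            intro x hx
            simp only [mem_sdiff, mem_insert, mem_erase, not_or, not_and] at hx ⊢
            by_cases hxi : x = i'
            · exact .inl hxi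
            · exact .inr ⟨hx.2.1, hx.1, hx.2.2 hxi⟩
          refine (card_le_card this).trans ((card_insert_le _ _).trans ?_)
          rwa [card_erase_add_one (mem_sdiff.2 ⟨hiD, hiD₀⟩)]
        · refine le_trans ?_ (ih _ hlt (insert i (D.erase i')) _
            (insert_subset_insert _ (erase_subset_erase _ hD₀D)) h2 ?_ rfl)
          · rw [sum_insert_erase hi'D hiD]
            linarith
          · refine (card_le_card fun x hx => ?_).trans hc
            simp only [mem_sdiff, mem_insert, mem_erase, not_or, not_and] at hx ⊢
            have h4 := hx.1.resolve_left hx.2.1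
            exact ⟨h4.2, hx.2.2 h4.1⟩
  · obtain ⟨E, hE, hEopt⟩ := exists_eq_maxWeight (v := v) (freeSet_empty B t)
    rw [← hEopt, ← sum_union hE.1.symm]
    refine le_maxWeight ⟨B, subset_union_left, hB, ?_⟩
    rw [union_sdiff_left]
    exact (card_le_card sdiff_subset).trans hE.2

theorem maxWeight_matchable_submodular [Nonempty σ] {Z : Finset σ} {i j : σ} (hij : i ≠ j)
    (hj : j ∉ Z) :
    maxWeight v (Matchable L (insert i (insert j Z))) + maxWeight v (Matchable L Z) ≤
      maxWeight v (Matchable L (insert i Z)) + maxWeight v (Matchable L (insert j Z)) := by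
  obtain ⟨D, hD, hDopt⟩ := exists_eq_maxWeight (v := v)
    (Matchable.exists_family (L := L) (X := insert i (insert j Z)))
  obtain ⟨E, hE, hEopt⟩ := exists_eq_maxWeight (v := v)
    (Matchable.exists_family (L := L) (X := Z))
  obtain ⟨D', E', h1, h2, h3, h4⟩ := hD.transfer (j := j)
    ((subset_insert _ _).trans (subset_insert _ _)) hj (by simp) hE
  rw [erase_insert_of_ne hij, erase_insert hj] at h1
  rw [← hDopt, ← hEopt, ← sum_union_inter, ← h3, ← h4, sum_union_inter]
  exact add_le_add (le_maxWeight h1) (le_maxWeight h2)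

theorem maxWeight_freeSet_anti {B' : Finset β} (h : B' ⊆ B) :
    maxWeight v (FreeSet B t) ≤ maxWeight v (FreeSet B' t) :=
  maxWeight_mono (freeSet_empty B t) fun _ hE => ⟨disjoint_of_subset_right h hE.1, hE.2⟩

theorem maxWeight_freeSet_mono {s : ℕ} (h : s ≤ t) :
    maxWeight v (FreeSet B s) ≤ maxWeight v (FreeSet B t) :=
  maxWeight_mono (freeSet_empty B s) fun _ hE => ⟨hE.1, hE.2.trans h⟩

theorem maxWeight_freeSet_succ_ge {A : Finset β} {θ : ℝ} (hθ : ∀ i ∈ A, θ ≤ v i)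
    (hA : t < #(A \ B)) :
    maxWeight v (FreeSet B t) + θ ≤ maxWeight v (FreeSet B (t + 1)) := by
  obtain ⟨E, hE, hEopt⟩ := exists_eq_maxWeight (v := v) (freeSet_empty B t)
  obtain ⟨x, hx, hxE⟩ := exists_mem_notMem_of_card_lt_card (hE.2.trans_lt hA)
  rw [mem_sdiff] at hx
  have h : FreeSet B (t + 1) (insert x E) :=
    ⟨disjoint_insert_left.2 ⟨hx.2, hE.1⟩, (card_insert_le _ _).trans (by have := hE.2; omega)⟩
  have := le_maxWeight (v := v) h
  rw [sum_insert hxE, hEopt] at this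
  linarith [hθ x hx.1]

/-- One buyer moves from the larger selection to the smaller one. This is what bounds the price of a
newcomer by the current platform price. -/
theorem maxWeight_freeSet_exchange {B' : Finset β} (h : B' ⊆ B) (hc : #B ≤ #B' + 1) :
    maxWeight v (FreeSet B' (t + 2)) + maxWeight v (FreeSet B t) ≤
      maxWeight v (FreeSet B' (t + 1)) + maxWeight v (FreeSet B (t + 1)) := by
  obtain ⟨E₁, hE₁, h₁⟩ := exists_eq_maxWeight (v := v) (freeSet_empty B' (t + 2))
  obtain ⟨E₂, hE₂, h₂⟩ := exists_eq_maxWeight (v := v) (freeSet_empty B t)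
  by_cases hlt : #E₁ ≤ t + 1
  · have h3 : FreeSet B' (t + 1) E₁ := ⟨hE₁.1, hlt⟩
    rw [← h₁]
    exact add_le_add (le_maxWeight h3) (maxWeight_freeSet_mono (by omega))
  have hcard : #(E₁ \ B) ≥ t + 1 := by
    have h4 : E₁ ⊆ (E₁ \ B) ∪ (B \ B') := by
      intro x hx
      have := disjoint_left.1 hE₁.1 hx
      simp only [mem_union, mem_sdiff]
      tauto
    have h5 := (card_le_card h4).trans (card_union_le _ _)
    rw [card_sdiff_of_subset h] at h5
    omega
  have h6 : #E₂ < #(E₁ \ B) := by have := hE₂.2; omega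
  obtain ⟨x, hx, hxE⟩ := exists_mem_notMem_of_card_lt_card h6
  rw [mem_sdiff] at hx
  have h7 : FreeSet B' (t + 1) (E₁.erase x) :=
    ⟨disjoint_of_subset_left (erase_subset _ _) hE₁.1, by
      rw [card_erase_of_mem hx.1]; have := hE₁.2; omega⟩
  have h8 : FreeSet B (t + 1) (insert x E₂) :=
    ⟨disjoint_insert_left.2 ⟨hx.2, hE₂.1⟩, (card_insert_le _ _).trans (by have := hE₂.2; omega)⟩
  have h9 := le_maxWeight (v := v) h7
  have h10 := le_maxWeight (v := v) h8
  rw [sum_insert hxE] at h10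
  have h11 := add_sum_erase E₁ v hx.1
  linarith

/-- If the best `t` buyers outside `B'` avoid `B`, enlarging `B'` to `B` displaces none of them. If
they meet `B`, one free seller is released and can serve a further buyer. -/
theorem maxWeight_freeSet_min (hv : ∀ i, 0 ≤ v i) {B' : Finset β} (h : B' ⊆ B) :
    min (∑ i ∈ B, v i - ∑ i ∈ B', v i)
        (maxWeight v (FreeSet B' (t + 1)) - maxWeight v (FreeSet B' t)) ≤
      ∑ i ∈ B, v i + maxWeight v (FreeSet B t) -
        (∑ i ∈ B', v i + maxWeight v (FreeSet B' t)) := by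
  obtain ⟨E, hE, hEopt⟩ := exists_eq_maxWeight (v := v) (freeSet_empty B' t)
  by_cases hdis : Disjoint E B
  · have h1 : FreeSet B t E := ⟨hdis, hE.2⟩
    have h2 := le_maxWeight (v := v) h1
    exact (min_le_left _ _).trans (by linarith)
  obtain ⟨b, hbE, hbB⟩ := not_disjoint_iff.1 hdis
  -- If an optimal selection for `t + 1` is larger than `t` and omits `b`, then `b` can replace some
  -- `x` in it: optimality of `E` gives `v x ≤ v b`.
  obtain ⟨E₁, hE₁, hE₁opt, hmeet⟩ : ∃ E₁, FreeSet B' (t + 1) E₁ ∧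
      maxWeight v (FreeSet B' (t + 1)) ≤ ∑ i ∈ E₁, v i ∧ (E₁ ∩ B).Nonempty := by
    obtain ⟨E₁, hE₁, h₁⟩ := exists_eq_maxWeight (v := v) (freeSet_empty B' (t + 1))
    by_cases hcard : #E₁ ≤ t
    · have h1 : FreeSet B' t E₁ := ⟨hE₁.1, hcard⟩
      have h2 := le_maxWeight (v := v) h1
      exact ⟨E, ⟨hE.1, by have := hE.2; omega⟩, by linarith, b, mem_inter.2 ⟨hbE, hbB⟩⟩
    by_cases hb : b ∈ E₁
    · exact ⟨E₁, hE₁, h₁.ge, b, mem_inter.2 ⟨hb, hbB⟩⟩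
    obtain ⟨x, hx, hxE⟩ := exists_mem_notMem_of_card_lt_card (hE.2.trans_lt (not_le.1 hcard))
    have hbB' := disjoint_left.1 hE.1 hbE
    have hxB' := disjoint_left.1 hE₁.1 hx
    have h1 : FreeSet B' t (insert x (E.erase b)) :=
      ⟨disjoint_insert_left.2 ⟨hxB', disjoint_of_subset_left (erase_subset _ _) hE.1⟩,
        (card_insert_le _ _).trans (by rw [card_erase_add_one hbE]; exact hE.2)⟩
    have h2 := le_maxWeight (v := v) h1
    rw [sum_insert_erase hbE hxE] at h2
    refine ⟨insert b (E₁.erase x),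
      ⟨disjoint_insert_left.2 ⟨hbB', disjoint_of_subset_left (erase_subset _ _) hE₁.1⟩,
        (card_insert_le _ _).trans (by rw [card_erase_add_one hx]; exact hE₁.2)⟩, ?_,
      b, by simp [hbB]⟩
    rw [sum_insert_erase hx hb]
    linarith
  have h1 : FreeSet B t (E₁ \ B) := by
    refine ⟨sdiff_disjoint, ?_⟩
    have h2 := card_sdiff_add_card_inter E₁ B
    have h3 := hmeet.card_pos
    have h4 := hE₁.2
    omega
  have h2 := le_maxWeight (v := v) h1
  have h3 : ∑ i ∈ E₁ ∩ B, v i ≤ ∑ i ∈ B \ B', v i := by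
    refine sum_le_sum_of_subset_of_nonneg (fun x hx => ?_) fun x _ _ => hv x
    rw [mem_inter] at hx
    exact mem_sdiff.2 ⟨hx.2, disjoint_left.1 hE₁.1 hx.1⟩
  have h4 := sum_sdiff (f := v) h
  have h5 := sum_inter_add_sum_sdiff E₁ B v
  exact (min_le_right _ _).trans (by linarith)

/-- Fix an optimal matching: an unused seller contributes nothing, and a used one at most the value
of its buyer. -/
theorem sum_marginal_le [Nonempty σ] :
    ∑ j ∈ S, (maxWeight v (Matchable L S) - maxWeight v (Matchable L (S.erase j))) ≤
      maxWeight v (Matchable L S) := by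
  classical
  obtain ⟨B, ⟨f, hf, hfS⟩, hB⟩ :=
    exists_eq_maxWeight (v := v) (Matchable.exists_family (L := L) (X := S))
  have himg : B.image f ⊆ S := by
    intro x hx
    obtain ⟨i, hi, rfl⟩ := mem_image.1 hx
    exact (hfS i hi).1
  have h1 : ∑ j ∈ S \ B.image f,
      (maxWeight v (Matchable L S) - maxWeight v (Matchable L (S.erase j))) ≤ 0 := by
    refine sum_nonpos fun j hj => ?_
    have := le_maxWeight (v := v) (Matchable.erase_of_forall_ne hf hfS (k := j)
      fun i hi h => (mem_sdiff.1 hj).2 (mem_image.2 ⟨i, hi, h⟩))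
    linarith
  have h2 : ∑ j ∈ B.image f,
      (maxWeight v (Matchable L S) - maxWeight v (Matchable L (S.erase j))) ≤ ∑ i ∈ B, v i := by
    rw [sum_image hf]
    refine sum_le_sum fun i hi => ?_
    have h3 := le_maxWeight (v := v) (Matchable.erase_erase hf hfS hi)
    have h4 := add_sum_erase B v hi
    linarith
  rw [← sum_sdiff himg, ← hB]
  rw [← hB] at h1 h2
  linarith

end Extended

/-! ### Maximum competitive prices as marginal contributions -/

namespace Market

variable {n m : ℕ} {N : Market n m} {v : Fin n → ℝ}

theorem sum_elim_price {p : Fin m → ℝ} {a : Fin n → Option (Fin m)}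
    (h : N.IsCompetitiveEquilibrium p a) : ∑ i, (a i).elim 0 p = ∑ j, p j := by
  have h1 : ∀ i, (a i).elim 0 p = ∑ j, if a i = some j then p j else 0 := by
    intro i
    cases hi : a i with
    | none => simp
    | some k => simp
  rw [sum_congr rfl fun i _ => h1 i, sum_comm]
  refine sum_congr rfl fun j _ => ?_
  by_cases hj : ∃ i, a i = some j
  · obtain ⟨i, hi⟩ := hj
    rw [sum_eq_single i]
    · simp [hi]
    · intro i' _ hne
      rw [if_neg fun h' => hne (h.feasible.2 _ _ _ h' hi)]
    · simp
  · push Not at hj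
    rw [h.unsold_price j hj]
    simp

theorem sum_utility_add_sum_price {p : Fin m → ℝ} {a : Fin n → Option (Fin m)}
    (h : N.IsCompetitiveEquilibrium p a) :
    ∑ i, N.buyerUtility p a i + ∑ j, p j = N.allocWelfare a := by
  rw [← sum_elim_price h, ← sum_add_distrib]
  refine sum_congr rfl fun i _ => ?_
  unfold buyerUtility
  cases a i <;> simp

/-- The allocation that gives the item of `f i` to each `i ∈ D`. -/
def matchingAlloc (D : Finset (Fin n)) (f : Fin n → Fin m) (i : Fin n) : Option (Fin m) :=
  if i ∈ D then some (f i) else none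

theorem matchingAlloc_eq_some {D : Finset (Fin n)} {f : Fin n → Fin m} {i : Fin n} {j : Fin m} :
    matchingAlloc D f i = some j ↔ i ∈ D ∧ f i = j := by
  unfold matchingAlloc
  split_ifs with h <;> simp [h]

theorem isFeasible_matchingAlloc {X : Finset (Fin m)} {D : Finset (Fin n)} {f : Fin n → Fin m}
    (hf : Set.InjOn f D) (hX : ∀ i ∈ D, f i ∈ X ∧ N.link i (f i)) :
    N.IsFeasible (matchingAlloc D f) := by
  simp only [IsFeasible, matchingAlloc_eq_some]
  refine ⟨?_, ?_⟩
  · rintro i j ⟨hi, rfl⟩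
    exact (hX i hi).2
  · rintro i i' j ⟨hi, hj⟩ ⟨hi', hj'⟩
    exact hf hi hi' (hj.trans hj'.symm)

theorem allocWelfare_matchingAlloc (hv : ∀ i j, N.value i j = v i) (D : Finset (Fin n))
    (f : Fin n → Fin m) : N.allocWelfare (matchingAlloc D f) = ∑ i ∈ D, v i := by
  unfold allocWelfare matchingAlloc
  rw [← sum_filter_add_sum_filter_not univ (· ∈ D)]
  rw [sum_congr (s₂ := D) (g := v) (by ext; simp)
    (fun i hi => by simp [hi, hv])]
  rw [add_eq_left]
  exact sum_eq_zero fun i hi => by simp [(mem_filter.1 hi).2]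

theorem exists_matchable_of_isFeasible [Nonempty (Fin m)] (hv : ∀ i j, N.value i j = v i)
    {a : Fin n → Option (Fin m)} (ha : N.IsFeasible a) :
    ∃ D, Matchable N.link univ D ∧ N.allocWelfare a = ∑ i ∈ D, v i := by
  refine ⟨univ.filter fun i => (a i).isSome,
    ⟨fun i => (a i).getD (Classical.arbitrary _), ?_, ?_⟩, ?_⟩
  · intro i hi i' hi' h
    simp only [coe_filter, mem_univ, true_and, Set.mem_ofPred_eq, Option.isSome_iff_exists] at hi hi'
    obtain ⟨j, hj⟩ := hi
    obtain ⟨j', hj'⟩ := hi'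
    simp only [hj, hj', Option.getD_some] at h
    exact ha.2 i i' j hj (h ▸ hj')
  · intro i hi
    simp only [mem_filter, mem_univ, true_and, Option.isSome_iff_exists] at hi
    obtain ⟨j, hj⟩ := hi
    simp [hj, ha.1 i j hj]
  · rw [sum_filter]
    refine sum_congr rfl fun i _ => ?_
    cases a i <;> simp [hv]

theorem welfare_eq [Nonempty (Fin m)] (hv : ∀ i j, N.value i j = v i) :
    N.welfare = maxWeight v (Matchable N.link univ) := by
  unfold welfare maxWeight
  congr 1
  ext w
  constructor
  · rintro ⟨a, ha, rfl⟩
    exact exists_matchable_of_isFeasible hv ha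
  · rintro ⟨D, ⟨f, hf, hX⟩, rfl⟩
    exact ⟨_, isFeasible_matchingAlloc hf hX, (allocWelfare_matchingAlloc hv D f).symm⟩

/-- The contribution of seller `j` to the optimal welfare. -/
noncomputable def marginal (v : Fin n → ℝ) (N : Market n m) (j : Fin m) : ℝ :=
  maxWeight v (Matchable N.link univ) - maxWeight v (Matchable N.link (univ.erase j))

/-- Linear programming duality: utilities plus prices sum to the welfare of the allocation, while
utilities plus the prices other than `p j` cover any matching that avoids `j`. -/
theorem price_le_marginal [Nonempty (Fin m)] (hv : ∀ i j, N.value i j = v i) {p : Fin m → ℝ}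
    {a : Fin n → Option (Fin m)} (h : N.IsCompetitiveEquilibrium p a) (j : Fin m) :
    p j ≤ marginal v N j := by
  obtain ⟨D, ⟨f, hf, hX⟩, hD⟩ := exists_eq_maxWeight (v := v)
    (Matchable.exists_family (L := N.link) (X := univ.erase j))
  obtain ⟨A, hA, hAw⟩ := exists_matchable_of_isFeasible hv h.feasible
  have h1 := le_maxWeight (v := v) hA
  have h2 := sum_utility_add_sum_price h
  have h3 : ∑ i ∈ D, v i ≤ ∑ i ∈ D, N.buyerUtility p a i + ∑ i ∈ D, p (f i) := by
    rw [← sum_add_distrib]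
    refine sum_le_sum fun i hi => ?_
    have := h.most_preferred i (f i) (hX i hi).2
    rw [hv] at this
    linarith
  have h4 : ∑ i ∈ D, N.buyerUtility p a i ≤ ∑ i, N.buyerUtility p a i :=
    sum_le_sum_of_subset_of_nonneg (subset_univ _) fun i _ _ => h.utility_nonneg i
  have h5 : ∑ i ∈ D, p (f i) ≤ ∑ k ∈ univ.erase j, p k := by
    rw [← sum_image hf]
    refine sum_le_sum_of_subset_of_nonneg (fun x hx => ?_) fun k _ _ => h.price_nonneg k
    obtain ⟨i, hi, rfl⟩ := mem_image.1 hx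
    exact (hX i hi).1
  have h6 := add_sum_erase univ p (mem_univ j)
  unfold marginal
  linarith

/-- Marginal contributions are competitive prices. -/
theorem exists_equilibrium_marginal [Nonempty (Fin m)] (hv : ∀ i j, N.value i j = v i) :
    ∃ a, N.IsCompetitiveEquilibrium (marginal v N) a := by
  obtain ⟨B, hBm, hB⟩ := exists_eq_maxWeight (v := v)
    (Matchable.exists_family (L := N.link) (X := univ))
  obtain ⟨f, hf, hX⟩ := id hBm
  have hnone : ∀ i, i ∉ B → N.buyerUtility (marginal v N) (matchingAlloc B f) i = 0 :=
    fun i hi => by simp [buyerUtility, matchingAlloc, hi]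
  have hsome : ∀ i ∈ B, N.buyerUtility (marginal v N) (matchingAlloc B f) i =
      v i - marginal v N (f i) :=
    fun i hi => by simp [buyerUtility, matchingAlloc, hi, hv]
  refine ⟨matchingAlloc B f, ?_, isFeasible_matchingAlloc hf hX, ?_, ?_, ?_⟩
  · intro j
    exact sub_nonneg.2 (maxWeight_mono Matchable.exists_family
      fun D hD => hD.mono_sellers (erase_subset _ _))
  · intro i j hL
    rw [hv]
    -- Compare with an optimum `D` inside `B` that avoids `j`. If `i ∈ B`, then `D` can also avoid
    -- `f i`, so `f i` is no dearer than `j`. If `i ∉ B`, then `j` could serve `i` on top of `D`, so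
    -- `j` costs at least `v i`.
    obtain ⟨D, hDB, hD, hDopt⟩ := exists_subset_optimal (erase_subset j univ) hBm hB
    by_cases hi : i ∈ B
    · rw [hsome i hi]
      have hD' : Matchable N.link (univ.erase (f i)) D := by
        have hf' : Set.InjOn f D := hf.mono (by exact_mod_cast hDB)
        have hX' : ∀ i ∈ D, f i ∈ univ ∧ N.link i (f i) := fun i hi => hX i (hDB hi)
        by_cases hiD : i ∈ D
        · exact Matchable.erase_of_link hf' hX' hiD (mem_univ j) hL hD
        · exact Matchable.erase_of_forall_ne hf' hX'
            fun x hx h => hiD (hf (hDB hx) hi h ▸ hx)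
      have := le_maxWeight (v := v) hD'
      unfold marginal
      linarith
    · rw [hnone i hi]
      have h1 := le_maxWeight (v := v) (hD.insert_of_erase (mem_univ j) hL)
      rw [sum_insert fun h => hi (hDB h)] at h1
      unfold marginal
      linarith
  · intro i
    by_cases hi : i ∈ B
    · rw [hsome i hi]
      have h1 := le_maxWeight (v := v) (Matchable.erase_erase hf hX hi)
      have h2 := add_sum_erase B v hi
      unfold marginal
      linarith
    · exact (hnone i hi).ge
  · intro j hj
    have h1 : Matchable N.link (univ.erase j) B := Matchable.erase_of_forall_ne hf hX
      fun i hi h => hj i (matchingAlloc_eq_some.2 ⟨hi, h⟩)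
    refine sub_eq_zero.2 (le_antisymm (hB ▸ le_maxWeight h1) ?_)
    exact maxWeight_mono Matchable.exists_family fun D hD => hD.mono_sellers (erase_subset _ _)

theorem maxPrice_eq [Nonempty (Fin m)] (hv : ∀ i j, N.value i j = v i) (j : Fin m) :
    N.maxPrice j = marginal v N j := by
  obtain ⟨a, ha⟩ := exists_equilibrium_marginal hv
  refine IsGreatest.csSup_eq ⟨⟨_, a, ha, rfl⟩, ?_⟩
  rintro r ⟨p, a', h, rfl⟩
  exact price_le_marginal hv h j

theorem maxPrice_nonneg [Nonempty (Fin m)] (hN : N.IsHomogeneous) (j : Fin m) :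
    0 ≤ N.maxPrice j := by
  obtain ⟨v, hv⟩ := hN
  rw [maxPrice_eq hv]
  exact (exists_equilibrium_marginal hv).choose_spec.price_nonneg j

theorem sum_maxPrice_le_welfare [Nonempty (Fin m)] (hN : N.IsHomogeneous)
    (P : Finset (Fin m)) : ∑ j ∈ P, N.maxPrice j ≤ N.welfare := by
  refine (sum_le_sum_of_subset_of_nonneg (subset_univ P)
    fun j _ _ => maxPrice_nonneg hN j).trans ?_
  obtain ⟨v, hv⟩ := hN
  have hv0 : ∀ i, 0 ≤ v i := fun i => hv i (Classical.arbitrary _) ▸ N.value_nonneg _ _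
  rw [welfare_eq hv, sum_congr rfl fun j _ => maxPrice_eq hv j]
  exact sum_marginal_le

/-- Only the number of platform sellers matters: each can serve any buyer, so they are
interchangeable. -/
theorem matchable_join {M : Market n m} {P X : Finset (Fin m)} {D : Finset (Fin n)} :
    Matchable (M.join P).link X D ↔ Extended M.link (X \ P) #(X ∩ P) D := by
  constructor
  · rintro ⟨f, hf, hX⟩
    refine ⟨D.filter (f · ∉ P), filter_subset _ _, ⟨f, hf.mono (by
      exact_mod_cast filter_subset _ D), ?_⟩, ?_⟩
    · intro i hi
      obtain ⟨hi, hiP⟩ := mem_filter.1 hi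
      exact ⟨mem_sdiff.2 ⟨(hX i hi).1, hiP⟩, (hX i hi).2.resolve_left hiP⟩
    · refine card_le_card_of_injOn f ?_ (hf.mono (by simp))
      intro i hi
      simp only [coe_sdiff, coe_filter, Set.mem_sdiff, mem_coe, Set.mem_ofPred_eq, not_and,
        not_not] at hi
      exact mem_inter.2 ⟨(hX i hi.1).1, hi.2 hi.1⟩
  · rintro ⟨D₀, hD₀, ⟨f, hf, hX⟩, hc⟩
    have hc' : Fintype.card ↥(D \ D₀) ≤ Fintype.card ↥(X ∩ P) := by
      simpa only [Fintype.card_coe] using hc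
    obtain ⟨e⟩ := Function.Embedding.nonempty_of_card_le hc'
    have he : ∀ x, (e x : Fin m) ∈ X ∧ (e x : Fin m) ∈ P := fun x => mem_inter.1 (e x).2
    have hmem : ∀ i ∈ D, i ∉ D \ D₀ → i ∈ D₀ := fun i hi h => by
      simpa [hi] using h
    refine ⟨fun i => if h : i ∈ D \ D₀ then e ⟨i, h⟩ else f i, ?_, ?_⟩
    · intro i hi i' hi' h
      rw [mem_coe] at hi hi'
      by_cases h1 : i ∈ D \ D₀ <;> by_cases h2 : i' ∈ D \ D₀
      · simp only [h1, h2, dif_pos] at h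
        simpa using e.injective (Subtype.ext h)
      · simp only [h1, h2, dif_pos, dif_neg, not_false_eq_true] at h
        exact absurd (he ⟨i, h1⟩).2 (h ▸ (mem_sdiff.1 (hX i' (hmem i' hi' h2)).1).2)
      · simp only [h1, h2, dif_pos, dif_neg, not_false_eq_true] at h
        exact absurd (he ⟨i', h2⟩).2 (h ▸ (mem_sdiff.1 (hX i (hmem i hi h1)).1).2)
      · simp only [h1, h2, dif_neg, not_false_eq_true] at h
        exact hf (hmem i hi h1) (hmem i' hi' h2) h
    · intro i hi
      by_cases h1 : i ∈ D \ D₀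
      · simp only [h1, dif_pos]
        exact ⟨(he _).1, .inl (he _).2⟩
      · simp only [h1, dif_neg, not_false_eq_true]
        have := hX i (hmem i hi h1)
        exact ⟨(mem_sdiff.1 this.1).1, .inr this.2⟩

/-! ### Prices on and off the platform -/

section Join

variable {M : Market n m} {P : Finset (Fin m)}

theorem value_join (hv : ∀ i j, M.value i j = v i) (P : Finset (Fin m)) :
    ∀ i j, (M.join P).value i j = v i := hv

theorem IsHomogeneous.join (hM : M.IsHomogeneous) (P : Finset (Fin m)) :
    (M.join P).IsHomogeneous := hM

theorem welfare_le_welfare_join [Nonempty (Fin m)] (hM : M.IsHomogeneous)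
    (P : Finset (Fin m)) : M.welfare ≤ (M.join P).welfare := by
  obtain ⟨v, hv⟩ := hM
  rw [welfare_eq hv, welfare_eq (value_join hv P)]
  refine maxWeight_mono Matchable.exists_family fun D ⟨f, hf, hX⟩ => ⟨f, hf, fun i hi => ?_⟩
  exact ⟨(hX i hi).1, .inr (hX i hi).2⟩

theorem maxPrice_join_of_mem [Nonempty (Fin m)] (hv : ∀ i j, M.value i j = v i) {j : Fin m}
    (hj : j ∈ P) : (M.join P).maxPrice j =
      maxWeight v (Extended M.link Pᶜ #P) - maxWeight v (Extended M.link Pᶜ (#P - 1)) := by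
  rw [maxPrice_eq (value_join hv P), marginal, maxWeight_congr fun D => matchable_join,
    maxWeight_congr fun D => matchable_join]
  have h1 : univ.erase j \ P = Pᶜ := by ext; simp; grind
  have h2 : univ.erase j ∩ P = P.erase j := by ext; simp
  rw [h1, h2, card_erase_of_mem hj, univ_inter, ← compl_eq_univ_sdiff]

theorem maxPrice_join_of_notMem [Nonempty (Fin m)] (hv : ∀ i j, M.value i j = v i) {j : Fin m}
    (hj : j ∉ P) : (M.join P).maxPrice j =
      maxWeight v (Extended M.link Pᶜ #P) - maxWeight v (Extended M.link (Pᶜ.erase j) #P) := by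
  rw [maxPrice_eq (value_join hv P), marginal, maxWeight_congr fun D => matchable_join,
    maxWeight_congr fun D => matchable_join]
  have h1 : univ.erase j \ P = Pᶜ.erase j := by ext; simp
  have h2 : univ.erase j ∩ P = P := by ext; simp; grind
  rw [h1, h2, univ_inter, ← compl_eq_univ_sdiff]

/-- Leaving the platform earns at most the contribution of the seller to the base network. -/
theorem maxPrice_join_erase_le [Nonempty (Fin m)] (hv : ∀ i j, M.value i j = v i) {i : Fin m}
    (hi : i ∈ P) : (M.join (P.erase i)).maxPrice i ≤
      maxWeight v (Matchable M.link (insert i Pᶜ)) - maxWeight v (Matchable M.link Pᶜ) := by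
  have hv0 : ∀ i, 0 ≤ v i := fun i => hv i (Classical.arbitrary _) ▸ M.value_nonneg _ _
  rw [maxPrice_join_of_notMem hv (notMem_erase i P), compl_erase,
    erase_insert (by simpa using hi)]
  obtain ⟨B, hBm, hB⟩ := exists_eq_maxWeight (v := v)
    (Matchable.exists_family (L := M.link) (X := insert i Pᶜ))
  obtain ⟨D, hDB, hD, hDopt⟩ := exists_subset_optimal (subset_insert i Pᶜ) hBm hB
  rw [maxWeight_extended hv0 hBm hB, maxWeight_extended hv0 hD hDopt, ← hB, ← hDopt]
  have := maxWeight_freeSet_anti (v := v) (t := #(P.erase i)) hDB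
  linarith

/-- A joining seller adds one unit of platform supply and frees at most one buyer from the outside
optimum, so the platform price cannot rise. -/
theorem maxPrice_join_insert_le [Nonempty (Fin m)] (hv : ∀ i j, M.value i j = v i) {i j : Fin m}
    (hi : i ∈ P) (hj : j ∉ P) :
    (M.join (insert j P)).maxPrice j ≤ (M.join P).maxPrice i := by
  have hv0 : ∀ i, 0 ≤ v i := fun i => hv i (Classical.arbitrary _) ▸ M.value_nonneg _ _
  rw [maxPrice_join_of_mem hv (mem_insert_self j P), maxPrice_join_of_mem hv hi,
    card_insert_of_notMem hj, compl_insert]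
  obtain ⟨B, hBm, hB⟩ := exists_eq_maxWeight (v := v)
    (Matchable.exists_family (L := M.link) (X := Pᶜ))
  obtain ⟨D, hDB, hD, hDopt, hc⟩ := exists_subset_optimal_card (j := j) hv0 hBm hB
  simp only [maxWeight_extended hv0 hBm hB, maxWeight_extended hv0 hD hDopt]
  obtain ⟨t, ht⟩ : ∃ t, #P = t + 1 := ⟨#P - 1, by have := card_pos.2 ⟨i, hi⟩; omega⟩
  have := maxWeight_freeSet_exchange (v := v) (t := t) hDB hc
  simp only [ht, Nat.add_sub_cancel]
  linarith

/-- This controls the temptation to join: staying outside earns the base contribution of `j` or the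
undiscounted price after joining, whichever is smaller. -/
theorem min_le_maxPrice_join [Nonempty (Fin m)] (hv : ∀ i j, M.value i j = v i) {j : Fin m}
    (hj : j ∉ P) :
    min (maxWeight v (Matchable M.link Pᶜ) - maxWeight v (Matchable M.link (Pᶜ.erase j)))
      ((M.join (insert j P)).maxPrice j) ≤ (M.join P).maxPrice j := by
  have hv0 : ∀ i, 0 ≤ v i := fun i => hv i (Classical.arbitrary _) ▸ M.value_nonneg _ _
  rw [maxPrice_join_of_mem hv (mem_insert_self j P), maxPrice_join_of_notMem hv hj,
    card_insert_of_notMem hj, compl_insert]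
  obtain ⟨B, hBm, hB⟩ := exists_eq_maxWeight (v := v)
    (Matchable.exists_family (L := M.link) (X := Pᶜ))
  obtain ⟨D, hDB, hD, hDopt⟩ := exists_subset_optimal (erase_subset j Pᶜ) hBm hB
  simp only [maxWeight_extended hv0 hBm hB, maxWeight_extended hv0 hD hDopt, ← hB, ← hDopt,
    Nat.add_sub_cancel]
  have := maxWeight_freeSet_min (t := #P) hv0 hDB
  rwa [add_sub_add_left_eq_sub]

/-- The platform price is at least `θ` if more buyers than needed value the item at `θ`. -/
theorem le_maxPrice_join [Nonempty (Fin m)] (hv : ∀ i j, M.value i j = v i) {i : Fin m}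
    (hi : i ∈ P) {A : Finset (Fin n)} {θ : ℝ} (hθ : ∀ i ∈ A, θ ≤ v i) (hA : 2 * #P ≤ #A + 1)
    (hθ0 : 0 < θ) (hW : 6 * M.welfare < #A * θ) : θ ≤ (M.join P).maxPrice i := by
  have hv0 : ∀ i, 0 ≤ v i := fun i => hv i (Classical.arbitrary _) ▸ M.value_nonneg _ _
  rw [maxPrice_join_of_mem hv hi]
  obtain ⟨B, hBm, hB⟩ := exists_eq_maxWeight (v := v)
    (Matchable.exists_family (L := M.link) (X := Pᶜ))
  simp only [maxWeight_extended hv0 hBm hB]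
  obtain ⟨t, ht⟩ : ∃ t, #P = t + 1 := ⟨#P - 1, by have := card_pos.2 ⟨i, hi⟩; omega⟩
  -- Every buyer of `A` in `B` is worth `θ` to the base network, so over five sixths of `A` remain
  -- for the platform, which supplies only about half.
  have hAB : 6 * #(A ∩ B) < #A := by
    have h1 : #(A ∩ B) * θ ≤ ∑ i ∈ A ∩ B, v i := by
      rw [← nsmul_eq_mul]
      exact card_nsmul_le_sum _ _ _ fun x hx => hθ x (mem_inter.1 hx).1
    have h2 : ∑ i ∈ A ∩ B, v i ≤ M.welfare := by
      rw [welfare_eq hv]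
      exact le_maxWeight ((hBm.mono_buyers inter_subset_right).mono_sellers (subset_univ _))
    have h3 : (6 * #(A ∩ B) : ℝ) * θ < #A * θ := by linarith
    exact_mod_cast lt_of_mul_lt_mul_right h3 hθ0.le
  have h4 := card_sdiff_add_card_inter A B
  have := maxWeight_freeSet_succ_ge (v := v) (t := t) (B := B) hθ (by omega)
  simp only [ht, Nat.add_sub_cancel]
  linarith

end Join

variable {M : Market n m}

/-! ### Expectations and pure profiles -/

section Expect

variable {x : Fin m → ℝ} {f g : Finset (Fin m) → ℝ}

theorem sum_joinProb (x : Fin m → ℝ) :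
    ∑ P : Finset (Fin m), (∏ j, if j ∈ P then x j else 1 - x j) = 1 := by
  have h := prod_add x (fun j => 1 - x j) (univ : Finset (Fin m))
  simp only [add_sub_cancel, prod_const_one, powerset_univ] at h
  refine (sum_congr rfl fun P _ => ?_).trans h.symm
  have h1 : univ.filter (· ∈ P) = P := by ext; simp
  have h2 : univ.filter (· ∉ P) = univ \ P := by ext; simp
  rw [prod_ite, h1, h2]

theorem joinProb_nonneg (hx : ∀ j, x j ∈ Set.Icc (0 : ℝ) 1) (P : Finset (Fin m)) :
    0 ≤ ∏ j, if j ∈ P then x j else 1 - x j := by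
  refine prod_nonneg fun j _ => ?_
  split_ifs
  · exact (hx j).1
  · linarith [(hx j).2]

theorem expect_const (x : Fin m → ℝ) (c : ℝ) : expect x (fun _ => c) = c := by
  rw [expect, ← sum_mul, sum_joinProb, one_mul]

theorem expect_mono (hx : ∀ j, x j ∈ Set.Icc (0 : ℝ) 1) (h : ∀ P, f P ≤ g P) :
    expect x f ≤ expect x g :=
  sum_le_sum fun P _ => mul_le_mul_of_nonneg_left (h P) (joinProb_nonneg hx P)

/-- The vector of joining probabilities at which exactly the sellers of `P` join. -/
def pureProfile (P : Finset (Fin m)) (j : Fin m) : ℝ := if j ∈ P then 1 else 0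

theorem expect_pureProfile (P : Finset (Fin m)) (f : Finset (Fin m) → ℝ) :
    expect (pureProfile P) f = f P := by
  unfold expect
  rw [sum_eq_single P]
  · rw [prod_eq_one, one_mul]
    intro j _
    by_cases h : j ∈ P <;> simp [pureProfile, h]
  · intro Q _ hQ
    obtain ⟨j, hj⟩ : ∃ j, ¬(j ∈ Q ↔ j ∈ P) := by
      by_contra! h
      exact hQ (ext h)
    rw [prod_eq_zero (mem_univ j), zero_mul]
    by_cases h1 : j ∈ Q <;> by_cases h2 : j ∈ P <;> simp_all [pureProfile]
  · simp

theorem update_pureProfile (P : Finset (Fin m)) (j : Fin m) :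
    Function.update (pureProfile P) j 0 = pureProfile (P.erase j) := by
  ext k
  by_cases h : k = j
  · subst h
    simp [pureProfile]
  · simp [pureProfile, h]

theorem isPlatformEquilibrium_pureProfile {α : ℝ} {P : Finset (Fin m)}
    (hin : ∀ j ∈ P, (M.join (P.erase j)).maxPrice j ≤ (1 - α) * (M.join P).maxPrice j)
    (hout : ∀ j ∉ P, (1 - α) * (M.join (insert j P)).maxPrice j ≤ (M.join P).maxPrice j) :
    M.IsPlatformEquilibrium α (pureProfile P) := by
  refine ⟨fun j => ?_, fun j => ?_⟩
  · unfold pureProfile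
    split_ifs <;> simp
  · rw [update_pureProfile, expect_pureProfile, expect_pureProfile, expect_pureProfile]
    by_cases hj : j ∈ P
    · rw [insert_erase hj]
      refine max_le ?_ le_rfl
      simpa [sellerUtility, hj] using hin j hj
    · rw [erase_eq_of_notMem hj]
      refine max_le le_rfl ?_
      simpa [sellerUtility, hj] using hout j hj

end Expect

/-! ### Existence of an optimum and an equilibrium with high revenue -/

section Existence

theorem continuous_expect {Z : Type*} [TopologicalSpace Z] {x : Z → Fin m → ℝ}
    {f : Z → Finset (Fin m) → ℝ} (hx : Continuous x) (hf : ∀ P, Continuous fun z => f z P) :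
    Continuous fun z => expect (x z) (f z) := by
  unfold expect
  refine continuous_finsetSum _ fun P _ => (continuous_finsetProd _ fun j _ => ?_).mul (hf P)
  split_ifs <;> fun_prop

theorem continuous_sellerUtility (P : Finset (Fin m)) (j : Fin m) :
    Continuous fun α => M.sellerUtility α P j := by
  unfold sellerUtility
  split_ifs <;> fun_prop

theorem exists_isPlatformOptimal [Nonempty (Fin m)] (hM : M.IsHomogeneous) :
    ∃ (α : ℝ) (x : Fin m → ℝ), M.IsPlatformOptimal α x := by
  let K : Set (ℝ × (Fin m → ℝ)) := {z | z.1 ∈ Set.Icc (0 : ℝ) 1 ∧ M.IsPlatformEquilibrium z.1 z.2}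
  have hclosed : IsClosed K := by
    have h1 : IsClosed {z : ℝ × (Fin m → ℝ) | ∀ j, z.2 j ∈ Set.Icc (0 : ℝ) 1} := by
      simp only [Set.ofPred_forall]
      exact isClosed_iInter fun j => isClosed_Icc.preimage (by fun_prop)
    have h2 : IsClosed {z : ℝ × (Fin m → ℝ) | ∀ j,
        max (expect (Function.update z.2 j 0) (fun P => M.sellerUtility z.1 P j))
          (expect (Function.update z.2 j 0) (fun P => M.sellerUtility z.1 (insert j P) j)) ≤
        expect z.2 (fun P => M.sellerUtility z.1 P j)} := by
      simp only [Set.ofPred_forall]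
      refine isClosed_iInter fun j => isClosed_le (Continuous.max ?_ ?_) ?_
      · exact continuous_expect (by fun_prop) fun P =>
          (continuous_sellerUtility P j).comp continuous_fst
      · exact continuous_expect (by fun_prop) fun P =>
          (continuous_sellerUtility (insert j P) j).comp continuous_fst
      · exact continuous_expect (by fun_prop) fun P =>
          (continuous_sellerUtility P j).comp continuous_fst
    exact (isClosed_Icc.preimage continuous_fst).inter (h1.inter h2)
  have hcompact : IsCompact K := by
    refine ((isCompact_Icc (a := (0 : ℝ)) (b := 1)).prod
      (isCompact_Icc (a := (0 : Fin m → ℝ)) (b := 1))).of_isClosed_subset hclosed ?_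
    rintro ⟨α, x⟩ ⟨hα, hx, -⟩
    exact ⟨hα, fun j => (hx j).1, fun j => (hx j).2⟩
  -- At fee `1` joining earns nothing, so an empty platform is an equilibrium.
  have hne : K.Nonempty := by
    refine ⟨(1, pureProfile ∅), by simp, isPlatformEquilibrium_pureProfile
      (fun j hj => absurd hj (notMem_empty j)) ?_⟩
    intro j _
    rw [sub_self, zero_mul]
    exact maxPrice_nonneg (hM.join ∅) j
  have hcont : Continuous fun z : ℝ × (Fin m → ℝ) => M.revenue z.1 z.2 :=
    continuous_expect continuous_snd fun P => by fun_prop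
  obtain ⟨⟨α, x⟩, hz, hmax⟩ := hcompact.exists_isMaxOn hne hcont.continuousOn
  exact ⟨α, x, hz.1, hz.2, fun α' hα' x' hx' => hmax (a := (α', x')) ⟨hα', hx'⟩⟩

theorem revenue_le_expectedWelfare [Nonempty (Fin m)] (hM : M.IsHomogeneous) {α : ℝ}
    {x : Fin m → ℝ} (hα : α ∈ Set.Icc (0 : ℝ) 1) (hx : ∀ j, x j ∈ Set.Icc (0 : ℝ) 1) :
    M.revenue α x ≤ M.expectedWelfare x := by
  refine expect_mono hx fun P => ?_
  refine (mul_le_of_le_one_left ?_ hα.2).trans (sum_maxPrice_le_welfare (hM.join P) P)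
  exact sum_nonneg fun j _ => maxPrice_nonneg (hM.join P) j

theorem welfare_le_expectedWelfare [Nonempty (Fin m)] (hM : M.IsHomogeneous)
    {x : Fin m → ℝ} (hx : ∀ j, x j ∈ Set.Icc (0 : ℝ) 1) :
    M.welfare ≤ M.expectedWelfare x := by
  rw [← expect_const x M.welfare]
  exact expect_mono hx fun P => welfare_le_welfare_join hM P

/-- A pure Platform Equilibrium in which as many sellers join as maximize the posted-price
revenue, up to constants. -/
theorem exists_equilibrium_revenue_ge [Nonempty (Fin m)] {v : Fin n → ℝ}
    (hv : ∀ i j, M.value i j = v i) (hm : 2 ≤ m) {A : Finset (Fin n)} (hA : A.Nonempty)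
    (hAm : #A ≤ m) {θ : ℝ} (hθ0 : 0 < θ) (hθ : ∀ i ∈ A, θ ≤ v i)
    (hW : 6 * M.welfare < #A * θ) :
    ∃ α ∈ Set.Icc (0 : ℝ) 1, ∃ x, M.IsPlatformEquilibrium α x ∧
      #A * θ ≤ 6 * M.revenue α x := by
  set W : Finset (Fin m) → ℝ := fun S => maxWeight v (Matchable M.link S) with hWdef
  have hApos := hA.card_pos
  -- Half of `A`, rounded up: small enough for excess demand on the platform, and `#A ≤ 3 * (m -
  -- s)`, where `#A = 1` needs `m ≥ 2`.
  obtain ⟨s, hs⟩ : ∃ s, s = (#A + 1) / 2 := ⟨_, rfl⟩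
  have hne : (powersetCard (m - s) (univ : Finset (Fin m))).Nonempty := by
    rw [powersetCard_nonempty]
    simp
  obtain ⟨S, hS, hSmax⟩ := exists_max_image _ W hne
  simp only [mem_powersetCard, subset_univ, true_and] at hS hSmax
  obtain ⟨P, rfl⟩ : ∃ P, S = Pᶜ := ⟨Sᶜ, by simp⟩
  have hPs : #P = s := by
    have := card_compl_add_card P
    rw [Fintype.card_fin] at this
    omega
  -- Swapping `j` for `i` does not improve the outside set; submodularity turns this into a
  -- comparison of marginals.
  have hwle : ∀ i ∈ P, ∀ j ∉ P, W (insert i Pᶜ) - W Pᶜ ≤ W Pᶜ - W (Pᶜ.erase j) := by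
    intro i hi j hj
    have hj' : j ∈ Pᶜ := by simpa using hj
    have hij : i ≠ j := fun h => hj (h ▸ hi)
    have h1 := maxWeight_matchable_submodular (v := v) (L := M.link) hij (notMem_erase j Pᶜ)
    rw [insert_erase hj'] at h1
    have h2 := hSmax (insert i (Pᶜ.erase j)) (by
      rw [card_insert_of_notMem (by simp [hi]), card_erase_add_one hj', hS])
    simp only [hWdef] at h2 ⊢
    linarith
  have hPne : P.Nonempty := card_pos.1 (by omega)
  obtain ⟨i₀, hi₀, hmax⟩ := exists_max_image P (fun i => W (insert i Pᶜ) - W Pᶜ) hPne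
  obtain ⟨μ, hμ⟩ : ∃ μ, μ = W (insert i₀ Pᶜ) - W Pᶜ := ⟨_, rfl⟩
  obtain ⟨q, hq⟩ : ∃ q, q = (M.join P).maxPrice i₀ := ⟨_, rfl⟩
  have hqall : ∀ i ∈ P, (M.join P).maxPrice i = q := fun i hi => by
    rw [hq, maxPrice_join_of_mem hv hi, maxPrice_join_of_mem hv hi₀]
  have hqθ : θ ≤ q := hq ▸ le_maxPrice_join hv hi₀ hθ (by omega) hθ0 hW
  have hμ0 : 0 ≤ μ := hμ ▸ sub_nonneg.2 (maxWeight_mono Matchable.exists_family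
    fun D hD => hD.mono_sellers (subset_insert _ _))
  -- The `m - s` outside sellers contribute at least `μ` each, so `#A * μ ≤ 3 * M.welfare`; the
  -- factor `6` in the hypothesis leaves a half.
  have hμθ : 2 * μ ≤ θ := by
    have h1 : ((m - s : ℕ) : ℝ) * μ ≤ M.welfare := by
      rw [← hS, ← nsmul_eq_mul]
      refine (card_nsmul_le_sum Pᶜ (fun j => W Pᶜ - W (Pᶜ.erase j)) μ fun j hj => ?_).trans
        (sum_marginal_le.trans ?_)
      · exact hμ ▸ hwle i₀ hi₀ j (by simpa using hj)
      · rw [welfare_eq hv]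
        exact maxWeight_mono Matchable.exists_family fun D hD => hD.mono_sellers (subset_univ _)
    have h2 : (#A : ℝ) ≤ 3 * ((m - s : ℕ) : ℝ) := by
      exact_mod_cast (by omega : #A ≤ 3 * (m - s))
    have h3 : (0 : ℝ) < #A := by exact_mod_cast hApos
    have h4 : (#A : ℝ) * μ ≤ 3 * ((m - s : ℕ) : ℝ) * μ := mul_le_mul_of_nonneg_right h2 hμ0
    refine le_of_mul_le_mul_left ?_ h3
    linarith
  have hq0 : 0 < q := hθ0.trans_le hqθ
  have hβq : μ / q * q = μ := div_mul_cancel₀ _ hq0.ne'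
  have hβ0 : 0 ≤ μ / q := div_nonneg hμ0 hq0.le
  have hβ : μ / q ≤ 1 / 2 := by
    rw [div_le_iff₀ hq0]
    linarith
  -- The fee leaves each platform seller exactly `μ`, and `μ / q ≤ 1 / 2` lets the platform keep at
  -- least half.
  refine ⟨1 - μ / q, ⟨by linarith, by linarith⟩, pureProfile P,
    isPlatformEquilibrium_pureProfile ?_ ?_, ?_⟩
  · intro i hi
    rw [hqall i hi, sub_sub_cancel, hβq, hμ]
    exact (maxPrice_join_erase_le hv hi).trans (hmax i hi)
  · intro j hj
    rw [sub_sub_cancel]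
    have h0 : 0 ≤ (M.join (insert j P)).maxPrice j :=
      maxPrice_nonneg (IsHomogeneous.join ⟨v, hv⟩ _) j
    refine le_trans (le_min ?_ ?_) (min_le_maxPrice_join hv hj)
    · calc μ / q * (M.join (insert j P)).maxPrice j ≤ μ / q * q :=
            mul_le_mul_of_nonneg_left (hq ▸ maxPrice_join_insert_le hv hi₀ hj) hβ0
        _ = W (insert i₀ Pᶜ) - W Pᶜ := by rw [hβq, hμ]
        _ ≤ _ := hwle i₀ hi₀ j hj
    · exact mul_le_of_le_one_left h0 (by linarith)
  · rw [revenue, expect_pureProfile, sum_congr rfl hqall, sum_const, nsmul_eq_mul, hPs]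
    have h1 : (#A : ℝ) ≤ 2 * s := by exact_mod_cast (by omega : #A ≤ 2 * s)
    have h2 : (0 : ℝ) ≤ s := by positivity
    have h3 : (s : ℝ) * θ ≤ s * q := mul_le_mul_of_nonneg_left hqθ h2
    have h4 : (#A : ℝ) * θ ≤ 2 * s * θ := mul_le_mul_of_nonneg_right h1 hθ0.le
    have h5 : (1 / 2 : ℝ) * (s * q) ≤ (1 - μ / q) * (s * q) :=
      mul_le_mul_of_nonneg_right (by linarith) (by positivity)
    have h6 : 0 ≤ (s : ℝ) * θ := by positivity
    linarith

end Existence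

end Market

/-! ### Harmonic summation and the conclusion -/

/-- The smallest value in `D` is at most `Φ / #D`; remove its buyer and repeat. -/
theorem sum_le_harmonic_mul {β : Type*} [DecidableEq β] {v : β → ℝ} {Φ : ℝ} (D : Finset β)
    (h : ∀ A ⊆ D, A.Nonempty → ∀ θ, (∀ i ∈ A, θ ≤ v i) → #A * θ ≤ Φ) :
    ∑ i ∈ D, v i ≤ (harmonic #D : ℝ) * Φ := by
  induction hn : #D generalizing D with
  | zero =>
    rw [card_eq_zero] at hn
    simp [hn]
  | succ k ih =>
    have hD : D.Nonempty := card_pos.1 (by omega)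
    obtain ⟨x, hx, hmin⟩ := exists_min_image D v hD
    have h1 := ih (D.erase x) (fun A hA => h A (hA.trans (erase_subset _ _)))
      (by rw [card_erase_of_mem hx, hn]; rfl)
    have h2 := h D subset_rfl hD _ hmin
    rw [hn] at h2
    have hpos : (0 : ℝ) < ((k + 1 : ℕ) : ℝ) := by positivity
    have h3 : v x ≤ ((k + 1 : ℕ) : ℝ)⁻¹ * Φ := by
      rw [inv_mul_eq_div, le_div_iff₀ hpos, mul_comm]
      exact h2
    rw [harmonic_succ, ← add_sum_erase D v hx]
    push_cast at h3 ⊢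
    linarith

theorem mainTheorem6 :
    ∃ c : ℝ, 0 < c ∧ ∀ (n m : ℕ), 2 ≤ min n m → ∀ M : Market n m, M.IsHomogeneous →
      (∃ (α : ℝ) (x : Fin m → ℝ), M.IsPlatformOptimal α x) ∧
      ∀ (α : ℝ) (x : Fin m → ℝ), M.IsPlatformOptimal α x →
        c / Real.log ((min n m : ℕ) : ℝ) * M.idealWelfare ≤ M.expectedWelfare x := by
  refine ⟨1 / 18, by norm_num, fun n m hnm M hM => ?_⟩
  have hm : 2 ≤ m := hnm.trans (min_le_right _ _)
  have : Nonempty (Fin m) := ⟨⟨0, by omega⟩⟩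
  refine ⟨Market.exists_isPlatformOptimal hM, fun α x ⟨hα, hx, hopt⟩ => ?_⟩
  have hrev := Market.revenue_le_expectedWelfare hM hα hx.1
  have hbase := Market.welfare_le_expectedWelfare hM hx.1
  obtain ⟨v, hv⟩ := hM
  have hE0 : 0 ≤ M.expectedWelfare x := by
    refine le_trans ?_ hbase
    rw [Market.welfare_eq hv]
    simpa using le_maxWeight (v := v) (Matchable.empty (L := M.link) (X := univ))
  have hv' : ∀ i j, M.complete.value i j = v i := hv
  obtain ⟨D, ⟨f, hf, -⟩, hD⟩ := exists_eq_maxWeight (v := v)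
    (Matchable.exists_family (L := M.complete.link) (X := univ))
  have hDn : #D ≤ n := by simpa using card_le_univ D
  have hDm : #D ≤ m := by
    rw [← card_image_of_injOn hf]
    simpa using card_le_univ (D.image f)
  have hsum := sum_le_harmonic_mul (v := v) (Φ := 6 * M.expectedWelfare x) D
    fun A hAD hA θ hθ => by
      rcases le_or_gt θ 0 with h0 | h0
      · exact (mul_nonpos_of_nonneg_of_nonpos (by positivity) h0).trans (by positivity)
      by_contra! hlt
      obtain ⟨α', hα', x', hx', h⟩ := Market.exists_equilibrium_revenue_ge hv hm hA
        ((card_le_card hAD).trans hDm) h0 hθ (by linarith)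
      linarith [hopt α' hα' x' hx']
  rw [Market.idealWelfare, Market.welfare_eq hv', ← hD]
  have hk : (2 : ℝ) ≤ ((min n m : ℕ) : ℝ) := by exact_mod_cast hnm
  have hlog : 1 / 2 ≤ Real.log ((min n m : ℕ) : ℝ) := by
    have := Real.log_le_log (by norm_num) hk
    linarith [Real.log_two_gt_d9]
  -- `harmonic #D ≤ 1 + log #D`, and `1 ≤ 2 * log (min n m)`; the resulting `3` times the `6` in `Φ`
  -- gives `18`.
  have hH : (harmonic #D : ℝ) ≤ 3 * Real.log ((min n m : ℕ) : ℝ) := by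
    have h1 := harmonic_le_one_add_log #D
    have h2 : Real.log (#D : ℝ) ≤ Real.log ((min n m : ℕ) : ℝ) := by
      rcases Nat.eq_zero_or_pos #D with h | h
      · rw [h, Nat.cast_zero, Real.log_zero]
        linarith
      · exact Real.log_le_log (by exact_mod_cast h) (by exact_mod_cast le_min hDn hDm)
    linarith
  have hle := mul_le_mul_of_nonneg_right hH (by positivity : 0 ≤ 6 * M.expectedWelfare x)
  rw [div_mul_eq_mul_div, div_le_iff₀ (by linarith)]
  linarith
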